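/- Let $\mathbb{K}$ be a field of characteristic zero, let $n \ge 2$, and let $f_1,\ldots,f_n \in \mathbb{K}[x,y]$ be $n$ linear forms (homogeneous polynomials of degree $1$) with $\gcd(f_i,f_j)=1$ for all $i \ne j$. Then $$\prod_{i=1}^n f_i \notin \bigcap_{1 \le i < j \le n} \langle f_i+z,\, f_j+z\rangle,$$ where $\langle f_i+z, f_j+z\rangle$ denotes the ideal of $\mathbb{K}[x,y,z]$ generated by $f_i+z$ and $f_j+z$. -/

import Mathlib

/-! If the product lay in every ideal, evaluating on the line `f i + z = f j + z = 0` would make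
some `f k` proportional to `f i - f j`. After a generic shear, each form becomes a node `x i = a i +
b i t` in `K[t]`, with the `b i` nonzero and distinct. Let `e i` be the Lagrange basis polynomial of
node `x i` evaluated at `0`, so that the `e i` sum to `1`. Put `H_b = ∑ b i / x i * (e i - 1)`, and
likewise `H_a`. Poles of `H_b` can occur only at roots of some `x i` or `x i - x j`, hence, by
proportionality, at a root of some `x k`. There they cancel: divided differences of integral data
are integral. So `H_b` is a polynomial vanishing at infinity, i.e. `0`. As `a i = x i - b i t`, `H_a
= (1 - n) - t H_b = 1 - n`; it also vanishes at infinity, so `n = 1` in `K`. -/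

open Polynomial in
/-- Divided differences of a polynomial at nodes of the coefficient ring stay in that ring. -/
theorem sum_eval_div_prod_sub_mem_range {ι O L : Type*} [DecidableEq ι] [CommRing O] [Field L]
    [Algebra O L] (hinj : Function.Injective (algebraMap O L)) (s : Finset ι) (x : ι → O)
    (hx : Set.InjOn x s) (g : O[X]) :
    ∑ i ∈ s, algebraMap O L (g.eval (x i)) /
        ∏ j ∈ s.erase i, (algebraMap O L (x i) - algebraMap O L (x j)) ∈
      (algebraMap O L).range := by
  have : Nontrivial O := (algebraMap O L).domain_nontrivial
  have hmon := Lagrange.nodal_monic (s := s) (v := x)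
  set r := g %ₘ Lagrange.nodal s x with hr
  have hdeg : (r.map (algebraMap O L)).degree < s.card := by
    refine degree_map_le.trans_lt ?_
    rw [← Lagrange.degree_nodal (s := s) (v := x)]
    exact degree_modByMonic_lt _ hmon
  have hev : ∀ i ∈ s, r.eval (x i) = g.eval (x i) := by
    intro i hi
    conv_rhs => rw [← modByMonic_add_div g (Lagrange.nodal s x)]
    simp [Lagrange.eval_nodal_at_node hi, hr]
  -- The sum is the top Lagrange coefficient of the remainder modulo the nodal polynomial, which is
  -- monic, so no division leaves `O`.
  refine ⟨r.coeff (s.card - 1), ?_⟩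
  rw [← coeff_map, Lagrange.coeff_eq_sum (v := fun i => algebraMap O L (x i))
    (fun i hi j hj h => hx hi hj (hinj h)) hdeg]
  refine Finset.sum_congr rfl fun i hi => ?_
  rw [eval_map_algebraMap, aeval_algebraMap_apply, aeval_def, Algebra.algebraMap_self, eval₂_id,
    hev i hi]

/-! ### Cancellation of poles over a local ring -/

section Local

variable {ι O L κ : Type*} [Fintype ι] [DecidableEq ι] [CommRing O] [Field L]
  [Algebra O L] [Field κ]

open Polynomial in
/-- The nodes of a residue class away from `0` contribute an integral term to the interpolation
at `0` of the values `b i / x i`. -/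
theorem sum_class_mem_range (hinj : Function.Injective (algebraMap O L)) (π : O →+* κ)
    (hπ : ∀ u, π u ≠ 0 → IsUnit u) (x b : ι → O) (hx : Function.Injective x) (k : ι)
    (y : κ) (c : O) (s : Finset ι) (hs : ∀ i, i ∈ s ↔ π (x i) = y) (hy : y ≠ 0)
    (hb : ∀ i ∈ s, b i * x k = (x i - c) * b k) (hk0 : x k ≠ 0) :
    ∑ i ∈ s, algebraMap O L (b i) / algebraMap O L (x i) *
        ∏ j ∈ Finset.univ.erase i,
          (algebraMap O L (x i) - algebraMap O L (x j))⁻¹ * (- algebraMap O L (x j)) ∈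
      (algebraMap O L).range := by
  set φ := algebraMap O L with hφ
  have hφ0 : ∀ u, u ≠ 0 → φ u ≠ 0 := fun u hu => (map_ne_zero_iff φ hinj).2 hu
  -- Nodes of `s` differ from `0` and from the other nodes by units, so a polynomial `U`
  -- interpolates the inverse of `X ^ 2 * nodal sᶜ` on `s`.
  have hcop : IsCoprime (X ^ 2 * Lagrange.nodal sᶜ x) (Lagrange.nodal s x) := by
    have hne : ∀ i ∈ s, π (x i) ≠ 0 := fun i hi => by rw [(hs i).1 hi]; exact hy
    refine IsCoprime.mul_left (IsCoprime.pow_left ?_) ?_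
    · refine IsCoprime.prod_right fun i hi => ?_
      have := isCoprime_X_sub_C_of_isUnit_sub (a := 0) (b := x i)
        (hπ _ (by simpa using hne i hi))
      simpa using this
    · refine IsCoprime.prod_right fun i hi => IsCoprime.prod_left fun j hj => ?_
      refine isCoprime_X_sub_C_of_isUnit_sub (hπ _ ?_)
      rw [map_sub, (hs i).1 hi]
      intro h
      exact (Finset.mem_compl.1 hj) ((hs j).2 (sub_eq_zero.1 h))
  obtain ⟨U, V, hUV⟩ := hcop
  have hUx : ∀ i ∈ s, U.eval (x i) * (x i ^ 2 * ∏ j ∈ sᶜ, (x i - x j)) = 1 := by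
    intro i hi
    have := congrArg (eval (x i)) hUV
    simpa [Lagrange.eval_nodal_at_node hi, Lagrange.eval_nodal] using this
  have key := sum_eval_div_prod_sub_mem_range hinj s x hx.injOn ((X - C c) * U)
  rw [← hφ] at key
  -- By `hb`, `b i` equals `(x i - c) * b k / x k`; the factor `x k` in the product of all nodes
  -- cancels this denominator.
  have hM := (φ.range).mul_mem ⟨b k * ∏ j ∈ Finset.univ.erase k, (- x j), rfl⟩ key
  convert hM using 1
  rw [Finset.mul_sum]
  refine Finset.sum_congr rfl fun i hi => ?_
  have hxi : x i ≠ 0 := fun h => by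
    have := (hs i).1 hi
    rw [h, map_zero] at this
    exact hy this.symm
  have hsplit : (Finset.univ.erase i) = s.erase i ∪ sᶜ := by
    ext j
    simp only [Finset.mem_erase, Finset.mem_univ, and_true, Finset.mem_union, Finset.mem_compl]
    constructor
    · intro h
      by_cases hj : j ∈ s
      · exact Or.inl ⟨h, hj⟩
      · exact Or.inr hj
    · rintro (h | h)
      · exact h.1
      · rintro rfl; exact h hi
  have hdisj : Disjoint (s.erase i) sᶜ :=
    (disjoint_compl_right (a := s)).mono_left (Finset.erase_subset _ _)
  have hP : (∏ j ∈ Finset.univ.erase i, (- φ (x j))) * φ (x i) =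
      (∏ j ∈ Finset.univ.erase k, (- φ (x j))) * φ (x k) := by
    have h1 := Finset.prod_erase_mul Finset.univ (fun j => - φ (x j)) (Finset.mem_univ i)
    have h2 := Finset.prod_erase_mul Finset.univ (fun j => - φ (x j)) (Finset.mem_univ k)
    linear_combination h2 - h1
  have hU := congrArg φ (hUx i hi)
  have hB := congrArg φ (hb i hi)
  rw [Finset.prod_mul_distrib, Finset.prod_inv_distrib]
  conv_lhs => enter [2, 1, 1]; rw [hsplit, Finset.prod_union hdisj]
  simp only [eval_mul, eval_sub, eval_X, eval_C, map_mul, map_sub, map_pow, map_prod, map_neg,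
    map_one] at hU hB ⊢
  have hA0 : ∏ j ∈ s.erase i, (φ (x i) - φ (x j)) ≠ 0 :=
    Finset.prod_ne_zero_iff.2 fun j hj => sub_ne_zero.2 fun h =>
      (Finset.ne_of_mem_erase hj) (hx (hinj h)).symm
  have hB0 : ∏ j ∈ sᶜ, (φ (x i) - φ (x j)) ≠ 0 := by
    intro h; rw [h] at hU; simp at hU
  generalize ∏ j ∈ s.erase i, (φ (x i) - φ (x j)) = A at *
  generalize ∏ j ∈ sᶜ, (φ (x i) - φ (x j)) = B at *
  generalize ∏ j ∈ Finset.univ.erase i, (- φ (x j)) = P at *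
  generalize ∏ j ∈ Finset.univ.erase k, (- φ (x j)) = Q at *
  have hxi' := hφ0 _ hxi
  have hxk' := hφ0 _ hk0
  have hUe : φ (U.eval (x i)) = (φ (x i) ^ 2 * B)⁻¹ := eq_inv_of_mul_eq_one_left hU
  rw [hUe]
  have hPe : P = Q * φ (x k) / φ (x i) := by rw [eq_div_iff hxi']; exact hP
  have hBe : φ (b i) = (φ (x i) - φ c) * φ (b k) / φ (x k) := by rw [eq_div_iff hxk']; exact hB
  rw [hPe, hBe]
  field_simp

/-- Interpolating the values `b i / x i` at the nodes `x i` and evaluating at `0` agrees with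
`∑ i, b i / x i` up to an integral term. -/
theorem sum_div_mul_basis_sub_one_mem_range (hinj : Function.Injective (algebraMap O L))
    (π : O →+* κ) (hπ : ∀ u, π u ≠ 0 → IsUnit u) (x b : ι → O) (hx : Function.Injective x)
    (k : ι) (σ : κ → O) (hxk : π (x k) = 0) (hk : ∀ i, i ≠ k → π (x i) ≠ 0)
    (hb : ∀ i, b i * x k = (x i - σ (π (x i))) * b k) (hk0 : x k ≠ 0) :
    ∑ i, algebraMap O L (b i) / algebraMap O L (x i) *
        (∏ j ∈ Finset.univ.erase i,
          (algebraMap O L (x i) - algebraMap O L (x j))⁻¹ * (- algebraMap O L (x j)) - 1) ∈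
      (algebraMap O L).range := by
  classical
  set φ := algebraMap O L with hφ
  have hunit : ∀ u, π u ≠ 0 → (φ u)⁻¹ ∈ φ.range := by
    intro u hu
    obtain ⟨w, hw⟩ := (hπ u hu).exists_right_inv
    refine ⟨w, eq_inv_of_mul_eq_one_right ?_⟩
    rw [← map_mul, hw, map_one]
  rw [← Finset.add_sum_erase _ _ (Finset.mem_univ k)]
  refine add_mem ?_ ?_
  -- Each factor is `1 - x k / (x k - x j)` with `x k - x j` a unit.
  · suffices h : ∃ w, ∏ j ∈ Finset.univ.erase k, (φ (x k) - φ (x j))⁻¹ * (- φ (x j)) =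
        1 + φ (x k) * φ w by
      obtain ⟨w, hw⟩ := h
      refine ⟨b k * w, ?_⟩
      have hxk' : φ (x k) ≠ 0 := (map_ne_zero_iff φ hinj).2 hk0
      rw [hw, map_mul]
      field_simp
      ring
    refine Finset.prod_induction _ (fun z => ∃ w, z = 1 + φ (x k) * φ w) ?_ ⟨0, by simp⟩ ?_
    · rintro _ _ ⟨u, rfl⟩ ⟨w, rfl⟩
      exact ⟨u + w + x k * u * w, by simp only [map_add, map_mul]; ring⟩
    · intro j hj
      have hj' : π (x k - x j) ≠ 0 := by
        rw [map_sub, hxk, zero_sub, neg_ne_zero]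
        exact hk j (Finset.ne_of_mem_erase hj)
      obtain ⟨w, hw⟩ := hunit _ hj'
      refine ⟨-w, ?_⟩
      have h0 : φ (x k) - φ (x j) ≠ 0 := by
        rw [← map_sub]
        refine (map_ne_zero_iff φ hinj).2 fun h => hj' (by rw [h, map_zero])
      rw [map_neg, hw, map_sub]
      field_simp
      ring
  · simp_rw [mul_sub]
    rw [Finset.sum_sub_distrib]
    refine sub_mem ?_ (sum_mem fun i hi => ?_)
    · rw [← Finset.sum_fiberwise_of_maps_to (g := fun i => π (x i))
        (fun i hi => Finset.mem_image_of_mem (fun i => π (x i)) hi)]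
      refine sum_mem fun y hy => ?_
      obtain ⟨i, hi, rfl⟩ := Finset.mem_image.1 hy
      have hi0 := hk i (Finset.ne_of_mem_erase hi)
      refine sum_class_mem_range hinj π hπ x b hx k (π (x i)) (σ (π (x i))) _ (fun j => ?_) hi0
        (fun j hj => ?_) hk0
      · simp only [Finset.mem_filter, Finset.mem_erase, Finset.mem_univ, and_true,
          and_iff_right_iff_imp]
        rintro h rfl
        exact hi0 (h ▸ hxk)
      · rw [hb j, (Finset.mem_filter.1 hj).2]
    · rw [mul_one, div_eq_mul_inv]
      exact mul_mem ⟨_, rfl⟩ (hunit _ (hk i (Finset.ne_of_mem_erase hi)))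

end Local

/-! ### Rational functions of one variable and their local rings -/

section Global

variable {ι K : Type*} [Fintype ι] [DecidableEq ι] [Field K]

/-- A rational function whose denominator can be chosen nonzero at each root of a split
polynomial that clears all denominators is a polynomial. -/
theorem RatFunc.exists_algebraMap_eq (h : RatFunc K) (D : Polynomial K) (hD : D.Splits)
    (hD0 : D ≠ 0) (hDh : ∃ p, algebraMap (Polynomial K) (RatFunc K) D * h = algebraMap (Polynomial K) (RatFunc K) p)
    (hloc : ∀ t, D.eval t = 0 → ∃ p d : Polynomial K, d.eval t ≠ 0 ∧
      algebraMap (Polynomial K) (RatFunc K) d * h = algebraMap (Polynomial K) (RatFunc K) p) :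
    ∃ p, h = algebraMap (Polynomial K) (RatFunc K) p := by
  have hden : ∀ d p : Polynomial K, d ≠ 0 →
      algebraMap (Polynomial K) (RatFunc K) d * h = algebraMap (Polynomial K) (RatFunc K) p → h.denom ∣ d := by
    intro d p hd hp
    refine (RatFunc.denom_dvd hd).2 ⟨p, ?_⟩
    rw [eq_div_iff (RatFunc.algebraMap_ne_zero hd), mul_comm, hp]
  obtain ⟨q, hq⟩ := hDh
  have hdvd := hden D q hD0 hq
  have hdeg : h.denom.degree = 0 := by
    by_contra hne
    obtain ⟨t, ht⟩ := (hD.of_dvd hD0 hdvd).exists_eval_eq_zero hne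
    obtain ⟨p, d, hd, hp⟩ := hloc t (by
      obtain ⟨r, hr⟩ := hdvd; rw [hr, Polynomial.eval_mul, ht, zero_mul])
    have hd0 : d ≠ 0 := by rintro rfl; simp at hd
    obtain ⟨r, hr⟩ := hden d p hd0 hp
    rw [hr, Polynomial.eval_mul, ht, zero_mul] at hd
    exact hd rfl
  have h1 : h.denom = 1 := Polynomial.Monic.natDegree_eq_zero (RatFunc.monic_denom h) |>.1
    (Polynomial.natDegree_eq_zero_iff_degree_le_zero.2 hdeg.le)
  refine ⟨h.num, ?_⟩
  conv_lhs => rw [← RatFunc.num_div_denom h, h1, map_one, div_one]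

open Polynomial in
/-- The interpolation at `0` of the values `b i / (a i + b i t)` at the nodes `a i + b i t`
differs from `∑ i, b i / (a i + b i t)` by a rational function without pole at the root of a
node. -/
theorem exists_denom_eval_ne_zero (a b : ι → K) (hb : ∀ i, b i ≠ 0)
    (hab : ∀ i j, i ≠ j → a i * b j ≠ a j * b i) (k : ι) (t : K) (ht : a k + b k * t = 0) :
    ∃ p d : K[X], d.eval t ≠ 0 ∧ algebraMap _ (RatFunc K) d *
      ∑ i, algebraMap K[X] (RatFunc K) (C (b i)) / algebraMap _ (RatFunc K) (C (a i) + C (b i) * X) *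
        (∏ j ∈ Finset.univ.erase i,
          (algebraMap _ (RatFunc K) (C (a i) + C (b i) * X) -
            algebraMap _ (RatFunc K) (C (a j) + C (b j) * X))⁻¹ *
            (- algebraMap _ (RatFunc K) (C (a j) + C (b j) * X)) - 1) =
      algebraMap _ (RatFunc K) p := by
  -- `O` is the local ring at `t` and `π` is evaluation there; `x i - x i(t) = b i * (X - t)`
  -- supplies the relation `hb`.
  set S : Submonoid K[X] := (nonZeroDivisors K).comap (evalRingHom t) with hS
  have hmem : ∀ q, q ∈ S ↔ q.eval t ≠ 0 := fun q => by
    rw [hS, Submonoid.mem_comap, mem_nonZeroDivisors_iff_ne_zero, coe_evalRingHom]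
  have hSle : S ≤ nonZeroDivisors K[X] := fun q hq => by
    rw [mem_nonZeroDivisors_iff_ne_zero]
    rintro rfl
    exact (hmem 0).1 hq (by simp)
  let O := Localization.subalgebra.ofField (RatFunc K) S hSle
  let π : O →+* K := IsLocalization.lift (M := S) (g := evalRingHom t)
    (fun q => isUnit_iff_ne_zero.2 ((hmem _).1 q.2))
  have hπe : ∀ q : K[X], π (algebraMap K[X] O q) = q.eval t := fun q => by
    simp only [π, IsLocalization.lift_eq, coe_evalRingHom]
  have hπ : ∀ u, π u ≠ 0 → IsUnit u := by
    intro u hu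
    obtain ⟨⟨q, s⟩, hqs⟩ := IsLocalization.surj S u
    have hq : q.eval t ≠ 0 := by
      rw [← hπe, ← hqs, map_mul, hπe]
      exact mul_ne_zero hu ((hmem _).1 s.2)
    have := IsLocalization.map_units O (⟨q, (hmem q).2 hq⟩ : S)
    rw [← hqs] at this
    exact isUnit_of_mul_isUnit_left this
  have hinjP : Function.Injective (algebraMap K[X] O) := IsLocalization.injective O hSle
  have hinj : Function.Injective (algebraMap O (RatFunc K)) := Subtype.val_injective
  have hroot : ∀ i, i ≠ k → a i + b i * t ≠ 0 := fun i hi h => hab i k hi (by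
    linear_combination b k * h - b i * ht)
  have := sum_div_mul_basis_sub_one_mem_range (L := RatFunc K) hinj π hπ
    (fun i => algebraMap K[X] O (C (a i) + C (b i) * X)) (fun i => algebraMap K[X] O (C (b i)))
    (fun i j hij => by
      by_contra hne
      have h := hinjP hij
      have h0 : a i = a j := by simpa using congrArg (fun q => coeff q 0) h
      have h1 : b i = b j := by simpa using congrArg (fun q => coeff q 1) h
      exact hab i j hne (by rw [h0, h1]))
    k (fun y => algebraMap K[X] O (C y)) (by rw [hπe]; simpa using ht)
    (fun i hi => by rw [hπe]; simpa using hroot i hi)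
    (fun i => by
      rw [hπe, ← map_mul, ← map_sub, ← map_mul]
      congr 1
      have : a k = - (b k * t) := by linear_combination ht
      rw [this]
      simp only [eval_add, eval_mul, eval_C, eval_X, map_neg, map_add, map_mul]
      ring)
    (fun h => by
      have h := hinjP (h.trans (map_zero _).symm)
      exact hb k (by simpa using congrArg (fun q => coeff q 1) h))
  obtain ⟨w, hw⟩ := this
  obtain ⟨p, d, hd, hpd⟩ := w.2
  refine ⟨p, d, (hmem d).1 hd, ?_⟩
  have hd0 : algebraMap K[X] (RatFunc K) d ≠ 0 :=
    RatFunc.algebraMap_ne_zero (nonZeroDivisors.ne_zero (hSle hd))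
  have hw' : (w : RatFunc K) = algebraMap O (RatFunc K) w := rfl
  rw [hw', hw] at hpd
  refine Eq.trans (congrArg _ hpd) ?_
  field_simp

end Global

/-! ### Behaviour at infinity and the count -/

section Main

variable {ι K : Type*} [Fintype ι] [DecidableEq ι] [Field K]

/-- The sum of the Lagrange basis polynomials, evaluated at `0`. -/
theorem sum_prod_inv_sub_mul_neg_eq_one {L : Type*} [Field L] [Nonempty ι] (x : ι → L)
    (hx : Function.Injective x) :
    ∑ i, ∏ j ∈ Finset.univ.erase i, (x i - x j)⁻¹ * (- x j) = 1 := by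
  have := congrArg (Polynomial.eval 0)
    (Lagrange.sum_basis (s := Finset.univ) (v := x) hx.injOn Finset.univ_nonempty)
  simpa [Polynomial.eval_finsetSum, Lagrange.basis, Polynomial.eval_prod,
    Lagrange.basisDivisor] using this

open Polynomial in
theorem inftyValuation_linear [DecidableEq (RatFunc K)] (a b : K) (hb : b ≠ 0) :
    RatFunc.inftyValuation K (algebraMap K[X] (RatFunc K) (C a + C b * X)) =
      WithZero.exp (1 : ℤ) := by
  have hd : (C a + C b * X).natDegree = 1 := by rw [add_comm]; exact natDegree_linear hb
  have h0 : (C a + C b * X) ≠ 0 := by intro h; rw [h] at hd; simp at hd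
  rw [RatFunc.inftyValuation_apply, RatFunc.inftyValuation.polynomial _ h0, hd]
  rfl

-- Distinct `b i` give each factor of the basis product degree `0`, while `c i / x i` has degree at
-- most `-1`.
open Polynomial in
theorem inftyValuation_sum_lt_one [DecidableEq (RatFunc K)] (a b c : ι → K) (hb : ∀ i, b i ≠ 0)
    (hbi : Function.Injective b) :
    RatFunc.inftyValuation K (∑ i, algebraMap K[X] (RatFunc K) (C (c i)) /
        algebraMap _ (RatFunc K) (C (a i) + C (b i) * X) *
        (∏ j ∈ Finset.univ.erase i,
          (algebraMap _ (RatFunc K) (C (a i) + C (b i) * X) -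
            algebraMap _ (RatFunc K) (C (a j) + C (b j) * X))⁻¹ *
            (- algebraMap _ (RatFunc K) (C (a j) + C (b j) * X)) - 1)) < 1 := by
  refine Valuation.map_sum_lt _ one_ne_zero fun i _ => ?_
  rw [map_mul, map_div₀, inftyValuation_linear _ _ (hb i)]
  have h1 : RatFunc.inftyValuation K (algebraMap K[X] (RatFunc K) (C (c i))) ≤ 1 := by
    by_cases h : c i = 0
    · simp [h]
    · rw [RatFunc.inftyValuation_apply, RatFunc.inftyValuation.polynomial _ (C_ne_zero.2 h), natDegree_C]
      simp
  have h2 : RatFunc.inftyValuation K (∏ j ∈ Finset.univ.erase i,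
          (algebraMap _ (RatFunc K) (C (a i) + C (b i) * X) -
            algebraMap _ (RatFunc K) (C (a j) + C (b j) * X))⁻¹ *
            (- algebraMap _ (RatFunc K) (C (a j) + C (b j) * X)) - 1) ≤ 1 := by
    refine (Valuation.map_sub _ _ _).trans (max_le ?_ (by simp))
    rw [map_prod]
    refine (Finset.prod_eq_one fun j hj => ?_).le
    have hne : b i - b j ≠ 0 := sub_ne_zero.2 fun h => (Finset.ne_of_mem_erase hj) (hbi h).symm
    have hs : (C (a i) + C (b i) * X) - (C (a j) + C (b j) * X) =
        C (a i - a j) + C (b i - b j) * X := by simp only [C_sub]; ring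
    rw [← map_sub, hs, map_mul, map_inv₀, Valuation.map_neg, inftyValuation_linear _ _ hne,
      inftyValuation_linear _ _ (hb j)]
    exact inv_mul_cancel₀ (by simp)
  calc _ ≤ 1 / WithZero.exp (1 : ℤ) * 1 := by gcongr; exact zero_le
    _ < 1 := by
      rw [mul_one, one_div, ← WithZero.exp_neg, ← WithZero.exp_zero, WithZero.exp_lt_exp]
      norm_num

theorem RatFunc.eq_zero_of_inftyValuation_lt_one {K : Type*} [Field K]
    [DecidableEq (RatFunc K)] (p : Polynomial K)
    (hp : RatFunc.inftyValuation K (algebraMap (Polynomial K) (RatFunc K) p) < 1) : p = 0 := by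
  by_contra h
  rw [RatFunc.inftyValuation_apply, RatFunc.inftyValuation.polynomial _ h, ← WithZero.exp_zero, WithZero.exp_lt_exp] at hp
  omega

-- By `hk`, every root of `x i - x j` is a root of some node, where the local lemma excludes a pole;
-- a polynomial vanishing at infinity is zero.
open Polynomial in
theorem sum_div_mul_basis_sub_one_eq_zero (a b : ι → K) (hb : ∀ i, b i ≠ 0)
    (hbi : Function.Injective b) (hab : ∀ i j, i ≠ j → a i * b j ≠ a j * b i)
    (hk : ∀ i j, i ≠ j → ∃ k, (a i - a j) * b k = (b i - b j) * a k) :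
    ∑ i, algebraMap K[X] (RatFunc K) (C (b i)) / algebraMap _ (RatFunc K) (C (a i) + C (b i) * X) *
        (∏ j ∈ Finset.univ.erase i,
          (algebraMap _ (RatFunc K) (C (a i) + C (b i) * X) -
            algebraMap _ (RatFunc K) (C (a j) + C (b j) * X))⁻¹ *
            (- algebraMap _ (RatFunc K) (C (a j) + C (b j) * X)) - 1) = 0 := by
  classical
  have hs : ∀ i j, (C (a i) + C (b i) * X) - (C (a j) + C (b j) * X) =
      C (a i - a j) + C (b i - b j) * X := fun i j => by simp only [C_sub]; ring
  have hlin : ∀ r s : K, s ≠ 0 → (C r + C s * X).Splits ∧ C r + C s * X ≠ 0 := by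
    intro r s h
    have hd : (C r + C s * X).natDegree = 1 := by rw [add_comm]; exact natDegree_linear h
    exact ⟨Splits.of_natDegree_eq_one hd, by intro h; rw [h] at hd; simp at hd⟩
  have hbs : ∀ i, ∀ j ∈ Finset.univ.erase i, b i - b j ≠ 0 := fun i j hj =>
    sub_ne_zero.2 fun h => (Finset.ne_of_mem_erase hj) (hbi h).symm
  have hlt := inftyValuation_sum_lt_one a b b hb hbi
  set h := ∑ i, algebraMap K[X] (RatFunc K) (C (b i)) /
      algebraMap _ (RatFunc K) (C (a i) + C (b i) * X) *
        (∏ j ∈ Finset.univ.erase i,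
          (algebraMap _ (RatFunc K) (C (a i) + C (b i) * X) -
            algebraMap _ (RatFunc K) (C (a j) + C (b j) * X))⁻¹ *
            (- algebraMap _ (RatFunc K) (C (a j) + C (b j) * X)) - 1) with hh
  let E : ι → K[X] := fun i => (C (a i) + C (b i) * X) *
    ∏ j ∈ Finset.univ.erase i, (C (a i - a j) + C (b i - b j) * X)
  obtain ⟨p, hp⟩ := RatFunc.exists_algebraMap_eq h (∏ i, E i)
    (Splits.prod fun i _ => (hlin _ _ (hb i)).1.mul
      (Splits.prod fun j hj => (hlin _ _ (hbs i j hj)).1))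
    (Finset.prod_ne_zero_iff.2 fun i _ => mul_ne_zero (hlin _ _ (hb i)).2
      (Finset.prod_ne_zero_iff.2 fun j hj => (hlin _ _ (hbs i j hj)).2))
    (by
      refine ⟨∑ i, (∏ j ∈ Finset.univ.erase i, E j) * (C (b i) *
        (∏ j ∈ Finset.univ.erase i, (-(C (a j) + C (b j) * X)) -
          ∏ j ∈ Finset.univ.erase i, (C (a i - a j) + C (b i - b j) * X))), ?_⟩
      rw [hh, Finset.mul_sum, map_sum]
      refine Finset.sum_congr rfl fun i _ => ?_
      rw [← Finset.prod_erase_mul _ _ (Finset.mem_univ i)]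
      generalize ∏ j ∈ Finset.univ.erase i, E j = Z
      rw [map_mul, map_mul, mul_assoc]
      rw [Finset.prod_mul_distrib, Finset.prod_inv_distrib]
      simp only [← map_sub (algebraMap K[X] (RatFunc K)), hs]
      have h1 := RatFunc.algebraMap_ne_zero (hlin (a i) _ (hb i)).2
      have h2 : algebraMap K[X] (RatFunc K)
          (∏ j ∈ Finset.univ.erase i, (C (a i - a j) + C (b i - b j) * X)) ≠ 0 :=
        RatFunc.algebraMap_ne_zero
          (Finset.prod_ne_zero_iff.2 fun j hj => (hlin _ _ (hbs i j hj)).2)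
      simp only [← map_neg (algebraMap K[X] (RatFunc K)),
        ← map_prod (algebraMap K[X] (RatFunc K))]
      rw [map_mul, map_mul, map_sub]
      field_simp)
    (by
      intro t ht
      suffices hr : ∃ k, a k + b k * t = 0 by
        obtain ⟨k, hk⟩ := hr
        exact exists_denom_eval_ne_zero a b hb hab k t hk
      rw [eval_prod, Finset.prod_eq_zero_iff] at ht
      obtain ⟨i, -, ht⟩ := ht
      simp only [E, eval_mul, eval_prod, mul_eq_zero, Finset.prod_eq_zero_iff] at ht
      rcases ht with ht | ⟨j, hj, ht⟩
      · exact ⟨i, by simpa using ht⟩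
      · obtain ⟨k, hk⟩ := hk i j (Finset.ne_of_mem_erase hj).symm
        have ht' : (a i - a j) + (b i - b j) * t = 0 := by simpa using ht
        refine ⟨k, (mul_eq_zero.1 (?_ : (b i - b j) * _ = 0)).resolve_left (hbs i j hj)⟩
        linear_combination b k * ht' - hk)
  rw [hp] at hlt ⊢
  rw [RatFunc.eq_zero_of_inftyValuation_lt_one p hlt, map_zero]

open Polynomial in
/-- Vectors `(a i, b i)` of the plane that are pairwise independent, and whose differences are
all multiples of vectors of the family, are `1` in number, as an element of the field. -/
theorem card_eq_one_of_differences_proportional [Nonempty ι] (a b : ι → K) (hb : ∀ i, b i ≠ 0)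
    (hbi : Function.Injective b) (hab : ∀ i j, i ≠ j → a i * b j ≠ a j * b i)
    (hk : ∀ i j, i ≠ j → ∃ k, (a i - a j) * b k = (b i - b j) * a k) :
    (Fintype.card ι : K) = 1 := by
  classical
  have hzero := sum_div_mul_basis_sub_one_eq_zero a b hb hbi hab hk
  have hlt := inftyValuation_sum_lt_one a b a hb hbi
  have hx0 : ∀ i, algebraMap _ (RatFunc K) (C (a i) + C (b i) * X) ≠ 0 := fun i h => by
    have := inftyValuation_linear (a i) (b i) (hb i)
    rw [h, map_zero] at this
    exact WithZero.exp_ne_zero this.symm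
  have hinj : Function.Injective
      (fun i => algebraMap _ (RatFunc K) (C (a i) + C (b i) * X)) := fun i j hij => by
    have h := RatFunc.algebraMap_injective K hij
    exact hbi (by simpa using congrArg (fun q => coeff q 1) h)
  have hone := sum_prod_inv_sub_mul_neg_eq_one _ hinj
  set e : ι → RatFunc K := fun i => ∏ j ∈ Finset.univ.erase i,
          (algebraMap _ (RatFunc K) (C (a i) + C (b i) * X) -
            algebraMap _ (RatFunc K) (C (a j) + C (b j) * X))⁻¹ *
            (- algebraMap _ (RatFunc K) (C (a j) + C (b j) * X)) with he
  change ∑ i, algebraMap K[X] (RatFunc K) (C (b i)) /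
    algebraMap _ (RatFunc K) (C (a i) + C (b i) * X) * (e i - 1) = 0 at hzero
  change RatFunc.inftyValuation K (∑ i, algebraMap K[X] (RatFunc K) (C (a i)) /
    algebraMap _ (RatFunc K) (C (a i) + C (b i) * X) * (e i - 1)) < 1 at hlt
  change ∑ i, e i = 1 at hone
  have hsum : ∑ i, algebraMap K[X] (RatFunc K) (C (a i)) /
      algebraMap _ (RatFunc K) (C (a i) + C (b i) * X) * (e i - 1) =
      algebraMap K[X] (RatFunc K) (C (1 - (Fintype.card ι : K))) := by
    have h1 : ∑ i, (e i - 1) = 1 - (Fintype.card ι : RatFunc K) := by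
      rw [Finset.sum_sub_distrib, hone]; simp
    have h2 : algebraMap K[X] (RatFunc K) (C (1 - (Fintype.card ι : K))) =
        1 - (Fintype.card ι : RatFunc K) := by simp
    rw [h2, ← h1, ← sub_zero (∑ i, (e i - 1)), ← mul_zero (algebraMap K[X] (RatFunc K) X),
      ← hzero, Finset.mul_sum, ← Finset.sum_sub_distrib]
    refine Finset.sum_congr rfl fun i _ => ?_
    have h3 := hx0 i
    have h4 : algebraMap K[X] (RatFunc K) (C (a i)) =
      algebraMap _ (RatFunc K) (C (a i) + C (b i) * X) -
        algebraMap K[X] (RatFunc K) (C (b i)) * algebraMap K[X] (RatFunc K) X := by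
      rw [map_add, map_mul]; ring
    rw [h4]
    field_simp
  rw [hsum] at hlt
  have := RatFunc.eq_zero_of_inftyValuation_lt_one _ hlt
  rw [C_eq_zero] at this
  exact (sub_eq_zero.1 this).symm

end Main

/-! ### From ideal membership to plane vectors -/

open MvPolynomial in
theorem MvPolynomial.IsHomogeneous.eq_linear_of_fin_two {R : Type*} [CommRing R]
    {f : MvPolynomial (Fin 2) R} (hf : f.IsHomogeneous 1) :
    ∃ α β : R, f = C α * X 0 + C β * X 1 := by
  have hmem : f ∈ homogeneousSubmodule (Fin 2) R 1 := hf
  rw [homogeneousSubmodule_one_eq_span_X, Submodule.mem_span_range_iff_exists_fun] at hmem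
  obtain ⟨c, rfl⟩ := hmem
  exact ⟨c 0, c 1, by simp [Fin.sum_univ_two, smul_eq_C_mul]⟩

theorem exists_forall_add_mul_ne_zero {ι K : Type*} [Fintype ι] [Field K] [Infinite K]
    (p q : ι → K) (h : ∀ i, p i ≠ 0 ∨ q i ≠ 0) : ∃ c, ∀ i, p i + c * q i ≠ 0 := by
  classical
  obtain ⟨c, hc⟩ := Infinite.exists_notMem_finset (Finset.univ.image fun i => - p i / q i)
  refine ⟨c, fun i hi => hc (Finset.mem_image.2 ⟨i, Finset.mem_univ _, ?_⟩)⟩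
  have hq : q i ≠ 0 := by
    intro hq
    rw [hq, mul_zero, add_zero] at hi
    exact (h i).elim (fun h => h hi) (fun h => h hq)
  field_simp
  linear_combination -hi

open MvPolynomial in
theorem det_ne_zero_of_isRelPrime {K : Type*} [Field K] {α β γ δ : K}
    (h : IsRelPrime (C α * X 0 + C β * X 1 : MvPolynomial (Fin 2) K) (C γ * X 0 + C δ * X 1)) :
    α * δ - β * γ ≠ 0 := by
  intro hdet
  have hunit : ∀ r s : K, ¬ IsUnit (C r * X 0 + C s * X 1 : MvPolynomial (Fin 2) K) := by
    intro r s hu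
    have := hu.map (eval (0 : Fin 2 → K))
    simp at this
  by_cases h0 : α = 0 ∧ β = 0
  · exact hunit γ δ (h (by simp [h0.1, h0.2]) dvd_rfl)
  · obtain ⟨c, hγ, hδ⟩ : ∃ c, γ = c * α ∧ δ = c * β := by
      by_cases hα : α = 0
      · have hβ : β ≠ 0 := fun hβ => h0 ⟨hα, hβ⟩
        refine ⟨δ / β, ?_, by field_simp⟩
        rw [hα] at hdet ⊢
        have : β * γ = 0 := by linear_combination -hdet
        simpa [hβ] using this
      · refine ⟨γ / α, by field_simp, ?_⟩
        field_simp
        linear_combination hdet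
    refine hunit α β (h dvd_rfl ⟨C c, ?_⟩)
    rw [hγ, hδ, map_mul, map_mul]
    ring

open MvPolynomial in
/-- Membership in the ideal of the line `f i + z = f j + z = 0`, evaluated at a point of it. -/
theorem exists_eq_of_prod_mem_span {ι K : Type*} [Fintype ι] [Field K] (α β : ι → K) (i j : ι)
    (h : (∏ k, rename Fin.castSucc (C (α k) * X 0 + C (β k) * X 1 : MvPolynomial (Fin 2) K) :
        MvPolynomial (Fin 3) K) ∈
      Ideal.span {rename Fin.castSucc (C (α i) * X 0 + C (β i) * X 1 : MvPolynomial (Fin 2) K) +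
          X 2,
        rename Fin.castSucc (C (α j) * X 0 + C (β j) * X 1 : MvPolynomial (Fin 2) K) + X 2}) :
    ∃ k, α k * (β i - β j) = β k * (α i - α j) := by
  -- The first two coordinates are a zero of `f i - f j`; the third is minus the value of `f i`
  -- there.
  let v : Fin 3 → K := ![β i - β j, α j - α i,
    -(α i * (β i - β j) + β i * (α j - α i))]
  have hev : ∀ k, eval v (rename Fin.castSucc
      (C (α k) * X 0 + C (β k) * X 1 : MvPolynomial (Fin 2) K)) =
      α k * (β i - β j) + β k * (α j - α i) := by
    intro k
    simp [v]
  have hle : Ideal.span {rename Fin.castSucc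
        (C (α i) * X 0 + C (β i) * X 1 : MvPolynomial (Fin 2) K) + X 2,
      rename Fin.castSucc (C (α j) * X 0 + C (β j) * X 1 : MvPolynomial (Fin 2) K) + X 2} ≤
      RingHom.ker (eval v) := by
    rw [Ideal.span_le, Set.insert_subset_iff, Set.singleton_subset_iff]
    constructor
    · rw [SetLike.mem_coe, RingHom.mem_ker, map_add, hev, eval_X]
      simp [v]
    · rw [SetLike.mem_coe, RingHom.mem_ker, map_add, hev, eval_X]
      simp only [v, Matrix.cons_val]
      ring
  have h0 := hle h
  rw [RingHom.mem_ker, map_prod, Finset.prod_eq_zero_iff] at h0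
  obtain ⟨k, -, hk⟩ := h0
  rw [hev] at hk
  exact ⟨k, by linear_combination hk⟩

theorem theorem3p6 {K : Type*} [Field K] [CharZero K] (n : ℕ) (hn : 2 ≤ n)
    -- linear forms in `K[x, y]`
    (f : Fin n → MvPolynomial (Fin 2) K) (hf : ∀ i, (f i).IsHomogeneous 1)
    -- `gcd (f i, f j) = 1`: every common divisor is a unit
    (hcop : ∀ i j, i ≠ j → IsRelPrime (f i) (f j)) :
    -- `K[x, y]` sits in `K[x, y, z]` through `x = X 0`, `y = X 1`; and `z = X 2`
    (∏ i, MvPolynomial.rename Fin.castSucc (f i) : MvPolynomial (Fin 3) K) ∉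
      ⨅ (i : Fin n) (j : Fin n) (_ : i < j),
        Ideal.span {MvPolynomial.rename Fin.castSucc (f i) + MvPolynomial.X 2,
          MvPolynomial.rename Fin.castSucc (f j) + MvPolynomial.X 2} := by
  intro hmem
  choose α β hαβ using fun i => (hf i).eq_linear_of_fin_two
  obtain rfl : f = fun i => _ := funext hαβ
  simp only [Ideal.mem_iInf] at hmem
  have hdet : ∀ i j, i ≠ j → α i * β j - β i * α j ≠ 0 := fun i j hij =>
    det_ne_zero_of_isRelPrime (hcop i j hij)
  have hprop : ∀ i j, i ≠ j → ∃ k, α k * (β i - β j) = β k * (α i - α j) := by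
    intro i j hij
    rcases hij.lt_or_gt with h | h
    · exact exists_eq_of_prod_mem_span α β i j (hmem i j h)
    · obtain ⟨k, hk⟩ := exists_eq_of_prod_mem_span α β j i (hmem j i h)
      exact ⟨k, by linear_combination -hk⟩
  have : Fact (1 < n) := ⟨hn⟩
  have : Nontrivial (Fin n) := Fin.nontrivial_iff_two_le.2 hn
  -- A shear avoiding finitely many values of `c` makes the second coordinates nonzero and distinct.
  obtain ⟨c, hc⟩ := exists_forall_add_mul_ne_zero
    (Sum.elim α fun s : {s : Fin n × Fin n // s.1 ≠ s.2} => α s.1.1 - α s.1.2)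
    (Sum.elim β fun s : {s : Fin n × Fin n // s.1 ≠ s.2} => β s.1.1 - β s.1.2) (by
      rintro (i | ⟨⟨i, j⟩, hij⟩) <;> by_contra! h
      · obtain ⟨j, hj⟩ := exists_ne i
        simp only [Sum.elim_inl] at h
        exact hdet i j hj.symm (by rw [h.1, h.2]; ring)
      · simp only [Sum.elim_inr] at h
        exact hdet i j hij (by linear_combination β j * h.1 - α j * h.2))
  have hcard := card_eq_one_of_differences_proportional β (fun i => α i + c * β i)
    (fun i => hc (Sum.inl i))
    (fun i j hij => by
      by_contra hne
      refine hc (Sum.inr ⟨(i, j), hne⟩) ?_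
      simp only [Sum.elim_inr]
      linear_combination hij)
    (fun i j hij h => hdet i j hij (by linear_combination -h))
    (fun i j hij => by
      obtain ⟨k, hk⟩ := hprop i j hij
      exact ⟨k, by linear_combination hk⟩)
  rw [Fintype.card_fin] at hcard
  have : n = 1 := by exact_mod_cast hcard
  omega
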